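/- For irrational $x\in(0,1)$ let $x=[0;a_1(x),a_2(x),\dots]$ be its regular continued fraction expansion, with positive integers $a_i(x)$, and let $p_n(x)/q_n(x)=[0;a_1(x),\dots,a_n(x)]$, in lowest terms, be its $n$-th convergent. Let $\lambda$ be the Lebesgue measure restricted to $[0,1]$, let $\log$ be the natural logarithm, and let $$K_0:=\prod_{k=1}^{\infty}\Bigl(1+\frac{1}{k(k+2)}\Bigr)^{\log k/\log 2}$$ be Khinchin's constant (the product converges). Put $$\alpha_0:=\frac{12\log 2}{\pi^2}\,\log K_0 .$$ Then $\alpha_0=0.8325\ldots$, that is, $0.8325\le\alpha_0<0.8326$, and for $\lambda$-almost every $x\in(0,1)$ $$\lim_{n\to\infty}\frac{\log\prod_{i=1}^{n}a_i(x)}{\log q_n(x)}=\alpha_0 .$$ Consequently $\lambda(\mathcal F_{\alpha_0})=1$, where, for $\alpha\in\mathbb R$, $\mathcal F_\alpha$ is the set of irrational $x\in(0,1)$ for which the limit $\lim_{n\to\infty}\log\bigl(\prod_{i=1}^{n}a_i(x)\bigr)/\log q_n(x)$ exists and equals $\alpha$. -/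

import Mathlib

open MeasureTheory Filter Topology

noncomputable section

namespace ContFracScaling

/-- The `i`-th digit, counted from `0`, of the regular continued fraction expansion of `x`: for an
irrational `x` in `(0, 1)` with expansion `[0; a₁, a₂, …]` this is `a_{i+1}`. (The value `0` is
taken only if the expansion terminates, that is, for some rational `x`.) -/
def digit (x : ℝ) (i : ℕ) : ℝ :=
  ((GenContFract.of x).partDens.get? i).getD 0

/-- The denominator `q_n(x)` of the `n`-th convergent `p_n(x) / q_n(x)` of `x`, written as a reduced
fraction. -/
def den (x : ℝ) (n : ℕ) : ℕ :=
  (Real.convergent x n).den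

/-- `log (a₁(x) ⋯ a_n(x)) / log q_n(x)`. -/
def scaling (x : ℝ) (n : ℕ) : ℝ :=
  Real.log (∏ i ∈ Finset.range n, digit x i) / Real.log (den x n)

/-- The set of irrational `x` in `(0, 1)` with arithmetic-geometric scaling `α`. -/
def levelSet (α : ℝ) : Set ℝ :=
  {x | x ∈ Set.Ioo (0 : ℝ) 1 ∧ Irrational x ∧ Tendsto (scaling x) atTop (𝓝 α)}

/-- The `k`-th factor of the infinite product that defines Khinchin's constant, `k ≥ 1`. -/
def khinchinFactor (k : ℕ+) : ℝ :=
  (1 + ((k : ℝ) * ((k : ℝ) + 2))⁻¹) ^ (Real.log (k : ℝ) / Real.log 2)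

/-- Khinchin's constant. -/
def khinchin : ℝ := ∏' k : ℕ+, khinchinFactor k

/-- `α₀ = (12 log 2 / π²) log K₀`. -/
def alphaZero : ℝ := 12 * Real.log 2 / Real.pi ^ 2 * Real.log khinchin

/-- Lebesgue measure restricted to `[0, 1]`. -/
def unitLebesgue : Measure ℝ := volume.restrict (Set.Icc (0 : ℝ) 1)

end ContFracScaling

end

/-! Digits are read off the orbit of the Gauss map T x = {1/x}: a_{i+1}(x) = ⌊1/Tⁱx⌋. Hence
log(a₁⋯a_n) is a Birkhoff sum of log⌊1/x⌋, and log q_n lies within log 2 of the Birkhoff sum of -log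
x (`log_den_mem_Icc`). T is ergodic for the Gauss measure (`ergodic_gaussMap`), so Birkhoff's
theorem makes both averages converge almost everywhere, and the quotient tends to the ratio of the
two integrals. These are log K₀ (`log_khinchin`), by splitting (0,1] according to the first digit,
and Lévy's constant π²/(12 log 2) (`integral_neg_log_gaussMeasure`), by a geometric series. The
Gauss measure and Lebesgue measure on (0,1] have the same null sets.

For the decimals, summation by parts turns log 2 · log K₀ into a sum of products of consecutive gaps
log((k+2)/(k+1)). Twenty terms are bounded by artanh expansions, and the tail is squeezed between
telescoping sums. -/

noncomputable section

/-! ### Birkhoff's pointwise ergodic theorem. -/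

section Birkhoff

variable {α : Type*} {T : α → α} {f : α → ℝ}

/-- The maximum of the first `n + 1` Birkhoff sums (including the empty one), by recursion. -/
def maxBirkhoffSum (T : α → α) (f : α → ℝ) : ℕ → α → ℝ
  | 0, _ => 0
  | n + 1, x => max 0 (f x + maxBirkhoffSum T f n (T x))

theorem maxBirkhoffSum_nonneg (n : ℕ) (x : α) : 0 ≤ maxBirkhoffSum T f n x := by
  cases n
  · exact le_rfl
  · exact le_max_left _ _

theorem birkhoffSum_le_maxBirkhoffSum (n : ℕ) (x : α) :
    birkhoffSum T f n x ≤ maxBirkhoffSum T f n x := by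
  induction n generalizing x with
  | zero => simp [maxBirkhoffSum]
  | succ n ih =>
    rw [birkhoffSum_succ']
    exact (by gcongr; exact ih _ : _ ≤ f x + maxBirkhoffSum T f n (T x)).trans (le_max_right _ _)

theorem maxBirkhoffSum_le_succ (n : ℕ) (x : α) :
    maxBirkhoffSum T f n x ≤ maxBirkhoffSum T f (n + 1) x := by
  induction n generalizing x with
  | zero => exact maxBirkhoffSum_nonneg _ _
  | succ n ih =>
    have := ih (T x)
    simp only [maxBirkhoffSum] at this ⊢
    gcongr

theorem monotone_maxBirkhoffSum (x : α) : Monotone fun n => maxBirkhoffSum T f n x :=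
  monotone_nat_of_le_succ fun n => maxBirkhoffSum_le_succ n x

/-- This makes the set of points with bounded maximal sums exactly invariant, so that ergodicity
gives it null or full measure. -/
theorem bddAbove_maxBirkhoffSum_comp (x : α) :
    BddAbove (Set.range fun n => maxBirkhoffSum T f n (T x)) ↔
      BddAbove (Set.range fun n => maxBirkhoffSum T f n x) := by
  constructor
  · rintro ⟨C, hC⟩
    refine ⟨max 0 (f x + C), ?_⟩
    rintro _ ⟨n, rfl⟩
    have : maxBirkhoffSum T f n (T x) ≤ C := hC ⟨n, rfl⟩
    refine (maxBirkhoffSum_le_succ n x).trans ?_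
    simp only [maxBirkhoffSum]
    gcongr
  · rintro ⟨C, hC⟩
    refine ⟨C - f x, ?_⟩
    rintro _ ⟨n, rfl⟩
    have : maxBirkhoffSum T f (n + 1) x ≤ C := hC ⟨n + 1, rfl⟩
    have h2 := le_max_right 0 (f x + maxBirkhoffSum T f n (T x))
    simp only [maxBirkhoffSum] at this ⊢
    linarith

/-- The left side has nonnegative integral, by monotonicity in `n` and invariance of the measure;
the right side tends to `f x` wherever the maximal sums at `T x` are unbounded. -/
theorem maxBirkhoffSum_succ_sub (n : ℕ) (x : α) :
    maxBirkhoffSum T f (n + 1) x - maxBirkhoffSum T f n (T x) =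
      max (-maxBirkhoffSum T f n (T x)) (f x) := by
  simp only [maxBirkhoffSum, zero_sub, add_sub_cancel_right, ← max_sub_sub_right]

variable [MeasurableSpace α] {μ : Measure α}

theorem measurable_maxBirkhoffSum (hT : Measurable T) (hf : Measurable f) (n : ℕ) :
    Measurable (maxBirkhoffSum T f n) := by
  induction n with
  | zero => exact measurable_const
  | succ n ih => exact measurable_const.max (hf.add (ih.comp hT))

theorem integrable_maxBirkhoffSum [IsFiniteMeasure μ] (hT : MeasurePreserving T μ μ)
    (hf : Integrable f μ) (n : ℕ) : Integrable (maxBirkhoffSum T f n) μ := by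
  induction n with
  | zero => exact integrable_const _
  | succ n ih => exact (integrable_const (0 : ℝ)).sup (hf.add (hT.integrable_comp_of_integrable ih))

/-- The Birkhoff sums of a function with negative integral are almost everywhere bounded above. -/
theorem Ergodic.ae_bddAbove_birkhoffSum [IsFiniteMeasure μ] (hT : Ergodic T μ)
    (hfm : Measurable f) (hf : Integrable f μ) (hneg : ∫ x, f x ∂μ < 0) :
    ∀ᵐ x ∂μ, BddAbove (Set.range fun n => birkhoffSum T f n x) := by
  have hTm := hT.measurable
  have hM := measurable_maxBirkhoffSum hTm hfm
  let A : Set α := {x | BddAbove (Set.range fun n => maxBirkhoffSum T f n x)}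
  have hA : MeasurableSet A := measurableSet_bddAbove_range hM
  have hTA : T ⁻¹' A = A := Set.ext fun x => bddAbove_maxBirkhoffSum_comp x
  rcases hT.toPreErgodic.ae_mem_or_ae_notMem hA hTA with h | h
  · filter_upwards [h] with x hx
    obtain ⟨C, hC⟩ := hx
    refine ⟨C, ?_⟩
    rintro _ ⟨n, rfl⟩
    exact (birkhoffSum_le_maxBirkhoffSum n x).trans (hC ⟨n, rfl⟩)
  · exfalso
    have hint := integrable_maxBirkhoffSum hT.toMeasurePreserving hf
    -- If almost every point had unbounded sums, these integrals, all nonnegative, would converge to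
    -- the negative integral of `f`; dominated convergence applies with bound |f|.
    have key : Tendsto (fun n => ∫ x, max (-maxBirkhoffSum T f n (T x)) (f x) ∂μ) atTop
        (𝓝 (∫ x, f x ∂μ)) := by
      refine tendsto_integral_of_dominated_convergence (fun x => |f x|) ?_ hf.abs ?_ ?_
      · exact fun n => (((hM n).comp hTm).neg.max hfm).aestronglyMeasurable
      · refine fun n => ae_of_all _ fun x => ?_
        have h0 := maxBirkhoffSum_nonneg (T := T) (f := f) n (T x)
        rw [Real.norm_eq_abs, abs_le]
        exact ⟨(neg_abs_le _).trans (le_max_right _ _),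
          max_le (by linarith [abs_nonneg (f x)]) (le_abs_self _)⟩
      · filter_upwards [h] with x hx
        have hx' : T x ∉ A := fun h => hx (hTA ▸ h)
        have hlim := (tendsto_atTop_of_monotone (monotone_maxBirkhoffSum (T := T) (f := f)
          (T x))).resolve_right fun ⟨l, hl⟩ => hx' hl.bddAbove_range
        refine tendsto_const_nhds.congr' ?_
        filter_upwards [hlim.eventually_ge_atTop (-f x)] with n hn
        rw [max_eq_right (by linarith)]
    refine absurd (ge_of_tendsto' key fun n => ?_) (not_le.2 hneg)
    simp only [← maxBirkhoffSum_succ_sub]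
    rw [integral_sub (hint _) (g := fun x => maxBirkhoffSum T f n (T x))
      (hT.toMeasurePreserving.integrable_comp_of_integrable (hint n))]
    have e : ∫ x, maxBirkhoffSum T f n (T x) ∂μ = ∫ x, maxBirkhoffSum T f n x ∂μ := by
      have := integral_map (μ := μ) hTm.aemeasurable (f := maxBirkhoffSum T f n)
        (by rw [hT.map_eq]; exact (hM n).aestronglyMeasurable)
      rw [← this, hT.map_eq]
    rw [e]
    exact sub_nonneg.2 (integral_mono (hint _) (hint _) fun x => maxBirkhoffSum_le_succ n x)

/-- For `c` strictly between the integral and `b`, the sums of `f - c` are bounded above by some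
`C`, so the averages of `f` are at most `C / n + c`. -/
theorem Ergodic.ae_eventually_birkhoffAverage_lt [IsProbabilityMeasure μ] (hT : Ergodic T μ)
    (hfm : Measurable f) (hf : Integrable f μ) {b : ℝ} (hb : ∫ x, f x ∂μ < b) :
    ∀ᵐ x ∂μ, ∀ᶠ n in atTop, birkhoffAverage ℝ T f n x < b := by
  obtain ⟨c, hc, hcb⟩ := exists_between hb
  have := hT.ae_bddAbove_birkhoffSum (f := fun x => f x - c) (hfm.sub_const c)
    (hf.sub (integrable_const c)) (by
      rw [integral_sub hf (integrable_const c)]; simpa using hc)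
  filter_upwards [this] with x ⟨C, hC⟩
  have hlim : Tendsto (fun n : ℕ => C / (n : ℝ) + c) atTop (𝓝 (0 + c)) :=
    (tendsto_const_div_atTop_nhds_zero_nat C).add_const c
  rw [zero_add] at hlim
  filter_upwards [hlim.eventually_lt_const hcb, eventually_gt_atTop 0] with n hn hn0
  refine lt_of_le_of_lt ?_ hn
  have h1 : birkhoffSum T (fun x => f x - c) n x ≤ C := hC ⟨n, rfl⟩
  have h2 : birkhoffSum T (fun x => f x - c) n x = birkhoffSum T f n x - n * c := by
    simp [birkhoffSum, Finset.sum_sub_distrib]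
  have hn' : (0 : ℝ) < n := by exact_mod_cast hn0
  rw [birkhoffAverage, smul_eq_mul, div_add' _ _ _ hn'.ne', inv_mul_eq_div]
  gcongr
  linarith

/-- **Birkhoff's pointwise ergodic theorem** for an ergodic map of a probability space. -/
theorem Ergodic.ae_tendsto_birkhoffAverage [IsProbabilityMeasure μ] (hT : Ergodic T μ)
    (hfm : Measurable f) (hf : Integrable f μ) :
    ∀ᵐ x ∂μ, Tendsto (fun n => birkhoffAverage ℝ T f n x) atTop (𝓝 (∫ x, f x ∂μ)) := by
  have h1 : ∀ k : ℕ, ∀ᵐ x ∂μ, ∀ᶠ n in atTop,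
      birkhoffAverage ℝ T f n x < ∫ x, f x ∂μ + 1 / ((k : ℝ) + 1) := fun k =>
    hT.ae_eventually_birkhoffAverage_lt hfm hf (lt_add_of_pos_right _ (by positivity))
  have h2 : ∀ k : ℕ, ∀ᵐ x ∂μ, ∀ᶠ n in atTop,
      birkhoffAverage ℝ T (-f) n x < -∫ x, f x ∂μ + 1 / ((k : ℝ) + 1) := fun k =>
    hT.ae_eventually_birkhoffAverage_lt hfm.neg hf.neg (by
      simp only [Pi.neg_apply, integral_neg]
      exact lt_add_of_pos_right _ (by positivity))
  filter_upwards [ae_all_iff.2 h1, ae_all_iff.2 h2] with x hx1 hx2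
  rw [Metric.tendsto_nhds]
  intro ε hε
  obtain ⟨k, hk⟩ := exists_nat_one_div_lt hε
  filter_upwards [hx1 k, hx2 k] with n hn1 hn2
  have : birkhoffAverage ℝ T (-f) n x = -birkhoffAverage ℝ T f n x := by
    simp [birkhoffAverage, birkhoffSum, Finset.sum_neg_distrib]
  rw [this] at hn2
  rw [Real.dist_eq, abs_lt]
  constructor <;> linarith

end Birkhoff

/-! ### The Gauss map and its invariant measure. -/

/-- The Gauss map `x ↦ {1 / x}`. -/
def gaussMap (x : ℝ) : ℝ := Int.fract x⁻¹

/-- The density `1 / (log 2 (1 + x))` of the Gauss measure. -/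
def gaussDensity (x : ℝ) : ℝ := (Real.log 2 * (1 + x))⁻¹

/-- The Gauss measure on `(0, 1]`. -/
def gaussMeasure : Measure ℝ :=
  (volume.restrict (Set.Ioc 0 1)).withDensity fun x => ENNReal.ofReal (gaussDensity x)

theorem measurable_gaussMap : Measurable gaussMap := measurable_fract.comp measurable_inv

theorem measurable_gaussDensity : Measurable gaussDensity :=
  (measurable_const.mul (measurable_const.add measurable_id)).inv

theorem gaussDensity_pos {x : ℝ} (hx : 0 ≤ x) : 0 < gaussDensity x := by
  have := Real.log_pos one_lt_two
  unfold gaussDensity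
  positivity

theorem gaussMap_mem_Ico (x : ℝ) : gaussMap x ∈ Set.Ico (0 : ℝ) 1 :=
  ⟨Int.fract_nonneg _, Int.fract_lt_one _⟩

instance : NullSingletonClass gaussMeasure := by
  unfold gaussMeasure
  infer_instance

theorem gaussMeasure_absolutelyContinuous : gaussMeasure ≪ volume.restrict (Set.Ioc 0 1) :=
  withDensity_absolutelyContinuous _ _

theorem restrict_absolutelyContinuous_gaussMeasure :
    volume.restrict (Set.Ioc 0 1) ≪ gaussMeasure := by
  refine withDensity_absolutelyContinuous' measurable_gaussDensity.ennreal_ofReal.aemeasurable ?_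
  filter_upwards [ae_restrict_mem measurableSet_Ioc] with x hx
  simpa using gaussDensity_pos hx.1.le

theorem ae_gaussMeasure_mem_Ioc : ∀ᵐ x ∂gaussMeasure, x ∈ Set.Ioc (0 : ℝ) 1 :=
  gaussMeasure_absolutelyContinuous.ae_le (ae_restrict_mem measurableSet_Ioc)

theorem integral_gaussDensity {a b : ℝ} (ha : 0 ≤ a) (hab : a ≤ b) :
    ∫ x in a..b, gaussDensity x = (Real.log (1 + b) - Real.log (1 + a)) / Real.log 2 := by
  have h2 := Real.log_pos one_lt_two
  have hc : ∀ x ∈ Set.uIcc a b, 1 + x ≠ 0 := fun x hx => by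
    rw [Set.uIcc_of_le hab] at hx
    linarith [hx.1]
  rw [intervalIntegral.integral_eq_sub_of_hasDerivAt
    (f := fun x => Real.log (1 + x) / Real.log 2) (f' := gaussDensity)]
  · ring
  · intro x hx
    have := (((hasDerivAt_id x).const_add 1).log (hc x hx)).div_const (Real.log 2)
    refine this.congr_deriv ?_
    rw [div_div, one_div, mul_comm]
    rfl
  · refine ContinuousOn.intervalIntegrable (ContinuousOn.inv₀ (by fun_prop) fun x hx => ?_)
    exact mul_ne_zero h2.ne' (hc x hx)

theorem gaussMeasure_Ioc {a b : ℝ} (ha : 0 ≤ a) (hab : a ≤ b) (hb : b ≤ 1) :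
    gaussMeasure (Set.Ioc a b) =
      ENNReal.ofReal ((Real.log (1 + b) - Real.log (1 + a)) / Real.log 2) := by
  have h2 := Real.log_pos one_lt_two
  rw [gaussMeasure, withDensity_apply _ measurableSet_Ioc, Measure.restrict_restrict
    measurableSet_Ioc, Set.inter_eq_left.2 (Set.Ioc_subset_Ioc ha hb), ← integral_gaussDensity ha hab,
    intervalIntegral.integral_of_le hab, ofReal_integral_eq_lintegral_ofReal]
  · refine (intervalIntegrable_iff_integrableOn_Ioc_of_le hab).1 ?_
    refine ContinuousOn.intervalIntegrable (ContinuousOn.inv₀ (by fun_prop) fun x hx => ?_)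
    rw [Set.uIcc_of_le hab] at hx
    have : 0 < 1 + x := by linarith [hx.1]
    positivity
  · filter_upwards [ae_restrict_mem measurableSet_Ioc] with x hx
    exact (gaussDensity_pos (ha.trans hx.1.le)).le

theorem gaussMeasure_inter_Ioc (s : Set ℝ) :
    gaussMeasure (s ∩ Set.Ioc 0 1) = gaussMeasure s :=
  measure_congr (by
    filter_upwards [ae_gaussMeasure_mem_Ioc] with x hx
    exact propext (and_iff_left hx))

instance : IsProbabilityMeasure gaussMeasure where
  measure_univ := by
    rw [← gaussMeasure_inter_Ioc, Set.univ_inter, gaussMeasure_Ioc le_rfl zero_le_one le_rfl]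
    have := Real.log_pos one_lt_two
    norm_num [this.ne']

/-- Here `k + 1` is the first digit of `x`: the condition says that 1/x lies in [k+1, k+1+t], and `t
< 1` pins down its floor. -/
theorem gaussMap_le_iff {x t : ℝ} (ht0 : 0 ≤ t) (ht1 : t < 1) (hx : x ∈ Set.Ioc (0 : ℝ) 1) :
    gaussMap x ≤ t ↔ ∃ k : ℕ, x ∈ Set.Icc ((k : ℝ) + 1 + t)⁻¹ ((k : ℝ) + 1)⁻¹ := by
  have hx1 : 1 ≤ x⁻¹ := (one_le_inv₀ hx.1).2 hx.2
  have key : ∀ k : ℕ, x ∈ Set.Icc ((k : ℝ) + 1 + t)⁻¹ ((k : ℝ) + 1)⁻¹ ↔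
      (k : ℝ) + 1 ≤ x⁻¹ ∧ x⁻¹ ≤ (k : ℝ) + 1 + t := fun k => by
    rw [Set.mem_Icc, inv_le_comm₀ (by positivity) hx.1, le_inv_comm₀ hx.1 (by positivity), and_comm]
  simp only [key]
  constructor
  · intro h
    refine ⟨⌊x⁻¹⌋₊ - 1, ?_⟩
    have h1 : 1 ≤ ⌊x⁻¹⌋₊ := Nat.le_floor (by simpa using hx1)
    have h3 := natCast_floor_eq_intCast_floor (zero_le_one.trans hx1)
    rw [Nat.cast_sub h1, Nat.cast_one, sub_add_cancel, h3]
    exact ⟨Int.floor_le _, by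
      have h4 : x⁻¹ - ⌊x⁻¹⌋ ≤ t := h
      linarith⟩
  · rintro ⟨k, h1, h2⟩
    have : ⌊x⁻¹⌋ = (k : ℤ) + 1 := by
      rw [Int.floor_eq_iff]
      push_cast
      exact ⟨h1, by linarith⟩
    rw [gaussMap, Int.fract, this]
    push_cast
    linarith

theorem hasSum_of_antitone_sub {g : ℕ → ℝ} (hg : Antitone g) (hlim : Tendsto g atTop (𝓝 0)) :
    HasSum (fun k => g k - g (k + 1)) (g 0) := by
  rw [hasSum_iff_tendsto_nat_of_nonneg fun k => sub_nonneg.2 (hg k.le_succ)]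
  simp only [Finset.sum_range_sub']
  simpa using hlim.const_sub (g 0)

/-- It suffices to compare half-lines. The preimage of (0,t] is a disjoint union of intervals, one
for each first digit, whose Gauss measures telescope to log(1+t)/log 2. -/
theorem measurePreserving_gaussMap : MeasurePreserving gaussMap gaussMeasure gaussMeasure := by
  refine ⟨measurable_gaussMap, ?_⟩
  have : IsFiniteMeasure (gaussMeasure.map gaussMap) := inferInstance
  refine Measure.ext_of_Iic _ _ fun t => ?_
  rw [Measure.map_apply measurable_gaussMap measurableSet_Iic]
  rcases lt_or_ge t 0 with ht0 | ht0
  · have e1 : gaussMap ⁻¹' Set.Iic t = ∅ :=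
      Set.eq_empty_of_forall_notMem fun x hx => not_lt.2 (gaussMap_mem_Ico x).1 (lt_of_le_of_lt hx ht0)
    rw [e1, ← gaussMeasure_inter_Ioc (Set.Iic t)]
    congr 1
    refine (Set.eq_empty_of_forall_notMem fun x hx => ?_).symm
    exact not_le.2 (ht0.trans hx.2.1) hx.1
  rcases le_or_gt 1 t with ht1 | ht1
  · have e1 : gaussMap ⁻¹' Set.Iic t = Set.univ :=
      Set.eq_univ_of_forall fun x => (gaussMap_mem_Ico x).2.le.trans ht1
    rw [e1, ← gaussMeasure_inter_Ioc (Set.Iic t), ← gaussMeasure_inter_Ioc Set.univ]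
    congr 1
    ext x
    simp only [Set.univ_inter, Set.mem_inter_iff, Set.mem_Iic]
    exact ⟨fun h => ⟨h.2.trans ht1, h⟩, fun h => h.2⟩
  have h2 := Real.log_pos one_lt_two
  have e1 : gaussMap ⁻¹' Set.Iic t ∩ Set.Ioc 0 1 =
      ⋃ k : ℕ, Set.Icc ((k : ℝ) + 1 + t)⁻¹ ((k : ℝ) + 1)⁻¹ := by
    ext x
    rw [Set.mem_iUnion]
    constructor
    · rintro ⟨h, hx⟩
      exact (gaussMap_le_iff ht0 ht1 hx).1 h
    · rintro ⟨k, hk⟩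
      have hx : x ∈ Set.Ioc (0 : ℝ) 1 :=
        ⟨lt_of_lt_of_le (by positivity) hk.1, hk.2.trans (inv_le_one_of_one_le₀ (by simp))⟩
      exact ⟨(gaussMap_le_iff ht0 ht1 hx).2 ⟨k, hk⟩, hx⟩
  have e2 : Set.Iic t ∩ Set.Ioc 0 1 = Set.Ioc 0 t := by
    ext x
    simp only [Set.mem_inter_iff, Set.mem_Iic, Set.mem_Ioc]
    exact ⟨fun h => ⟨h.2.1, h.1⟩, fun h => ⟨h.2, h.1, h.2.trans ht1.le⟩⟩
  rw [← gaussMeasure_inter_Ioc, e1, ← gaussMeasure_inter_Ioc (Set.Iic t), e2,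
    gaussMeasure_Ioc le_rfl ht0 ht1.le]
  have hle : ∀ k : ℕ, ((k : ℝ) + 1 + t)⁻¹ ≤ ((k : ℝ) + 1)⁻¹ := fun k =>
    inv_anti₀ (by positivity) (by linarith)
  have hdisj : Pairwise (Function.onFun Disjoint
      fun k : ℕ => Set.Icc ((k : ℝ) + 1 + t)⁻¹ ((k : ℝ) + 1)⁻¹) := by
    refine (pairwise_disjoint_on _).2 fun m n hmn => Set.disjoint_left.2 fun x hm hn => ?_
    have h1 : (m : ℝ) + 1 ≤ n := by exact_mod_cast hmn
    have h3 : ((n : ℝ) + 1)⁻¹ < ((m : ℝ) + 1 + t)⁻¹ :=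
      inv_strictAnti₀ (by positivity) (by linarith)
    exact not_le.2 h3 (hm.1.trans hn.2)
  rw [measure_iUnion hdisj fun k => measurableSet_Icc]
  let g : ℕ → ℝ := fun k => Real.log (1 + t / ((k : ℝ) + 1)) / Real.log 2
  have hg : Antitone g := fun m n hmn => by
    have : (m : ℝ) ≤ n := by exact_mod_cast hmn
    simp only [g]
    gcongr
  have hlim : Tendsto g atTop (𝓝 0) := by
    have h1 : Tendsto (fun k : ℕ => 1 + t / ((k : ℝ) + 1)) atTop (𝓝 1) := by
      have : Tendsto (fun k : ℕ => t / ((k : ℝ) + 1)) atTop (𝓝 0) :=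
        tendsto_const_nhds.div_atTop (tendsto_natCast_atTop_atTop.atTop_add tendsto_const_nhds)
      simpa using this.const_add 1
    simpa using (h1.log one_ne_zero).div_const (Real.log 2)
  have hsum := hasSum_of_antitone_sub hg hlim
  have hterm : ∀ k : ℕ, gaussMeasure (Set.Icc ((k : ℝ) + 1 + t)⁻¹ ((k : ℝ) + 1)⁻¹) =
      ENNReal.ofReal (g k - g (k + 1)) := fun k => by
    rw [← measure_congr Ioc_ae_eq_Icc, gaussMeasure_Ioc (by positivity) (hle k)
      (inv_le_one_of_one_le₀ (by simp))]
    congr 1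
    simp only [g]
    have p1 : (0 : ℝ) < k + 1 := by positivity
    have p2 : (0 : ℝ) < k + 1 + 1 := by positivity
    have p3 : (0 : ℝ) < k + 1 + t := by positivity
    have p4 : (0 : ℝ) < k + 1 + 1 + t := by positivity
    rw [← sub_div]
    congr 1
    push_cast
    rw [← Real.log_div (by positivity) (by positivity), ← Real.log_div (by positivity) (by positivity)]
    congr 1
    field_simp
    ring
  simp only [hterm]
  rw [← ENNReal.ofReal_tsum_of_nonneg (fun k => sub_nonneg.2 (hg k.le_succ)) hsum.summable,
    hsum.tsum_eq]
  simp [g]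

/-! ### Inverse branches and convergents. -/

theorem gaussMap_mem_Ioo {x : ℝ} (hx : Irrational x) :
    Irrational (gaussMap x) ∧ gaussMap x ∈ Set.Ioo (0 : ℝ) 1 := by
  have hi : Irrational (gaussMap x) := hx.inv.sub_intCast ⌊x⁻¹⌋
  exact ⟨hi, lt_of_le_of_ne (gaussMap_mem_Ico x).1 hi.ne_zero.symm, (gaussMap_mem_Ico x).2⟩

theorem iterate_gaussMap_mem_Ioo {x : ℝ} (hx : Irrational x) (hx1 : x ∈ Set.Ioo (0 : ℝ) 1)
    (n : ℕ) : Irrational (gaussMap^[n] x) ∧ gaussMap^[n] x ∈ Set.Ioo (0 : ℝ) 1 := by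
  induction n generalizing x with
  | zero => exact ⟨hx, hx1⟩
  | succ n ih => exact ih (gaussMap_mem_Ioo hx).1 (gaussMap_mem_Ioo hx).2

theorem one_le_floor_inv {x : ℝ} (hx : x ∈ Set.Ioo (0 : ℝ) 1) : 1 ≤ ⌊x⁻¹⌋₊ :=
  Nat.le_floor (by simpa using (one_le_inv₀ hx.1).2 hx.2.le)

theorem floor_inv_add_gaussMap {x : ℝ} (hx : 0 < x) : (⌊x⁻¹⌋₊ : ℝ) + gaussMap x = x⁻¹ := by
  rw [natCast_floor_eq_intCast_floor (inv_nonneg.2 hx.le)]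
  exact Int.floor_add_fract _

theorem convergent_eq_floor_add (y : ℝ) (n : ℕ) :
    y.convergent n = ⌊y⌋ + (Int.fract y).convergent n := by
  cases n <;> simp

theorem convergent_succ_eq_inv {x : ℝ} (hx : x ∈ Set.Ioo (0 : ℝ) 1) (n : ℕ) :
    x.convergent (n + 1) = (⌊x⁻¹⌋₊ + (gaussMap x).convergent n)⁻¹ := by
  have h0 : ⌊x⌋ = 0 := Int.floor_eq_zero_iff.2 ⟨hx.1.le, hx.2⟩
  have h1 : (⌊x⁻¹⌋₊ : ℚ) = (⌊x⁻¹⌋ : ℚ) := by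
    exact_mod_cast Int.natCast_floor_eq_floor (inv_nonneg.2 hx.1.le)
  rw [Real.convergent_succ, h0, Int.fract_eq_self.2 ⟨hx.1.le, hx.2⟩, convergent_eq_floor_add, h1]
  simp [gaussMap]

/-- The inverse branch of the `n`-th iterate of the Gauss map that takes the value `x` at
`gaussMap^[n] x`: `t ↦ [0; a₁(x), …, a_n(x) + t]`. -/
def gaussBranch : ℕ → ℝ → ℝ → ℝ
  | 0, _, t => t
  | n + 1, x, t => (⌊x⁻¹⌋₊ + gaussBranch n (gaussMap x) t)⁻¹

theorem gaussBranch_iterate {x : ℝ} (hx : Irrational x) (hx1 : x ∈ Set.Ioo (0 : ℝ) 1) (n : ℕ) :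
    gaussBranch n x (gaussMap^[n] x) = x := by
  induction n generalizing x with
  | zero => rfl
  | succ n ih =>
    have h := gaussMap_mem_Ioo hx
    rw [gaussBranch, Function.iterate_succ_apply, ih h.1 h.2, floor_inv_add_gaussMap hx1.1, inv_inv]

theorem iterate_gaussBranch {x : ℝ} (hx : Irrational x) (hx1 : x ∈ Set.Ioo (0 : ℝ) 1) (n : ℕ)
    {t : ℝ} (ht : t ∈ Set.Ioo (0 : ℝ) 1) :
    gaussBranch n x t ∈ Set.Ioo (0 : ℝ) 1 ∧ gaussMap^[n] (gaussBranch n x t) = t := by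
  induction n generalizing x with
  | zero => exact ⟨ht, rfl⟩
  | succ n ih =>
    have h := gaussMap_mem_Ioo hx
    obtain ⟨h1, h2⟩ := ih h.1 h.2
    have ha : (1 : ℝ) ≤ ⌊x⁻¹⌋₊ := by exact_mod_cast one_le_floor_inv hx1
    refine ⟨⟨?_, ?_⟩, ?_⟩
    · exact inv_pos.2 (by linarith [h1.1])
    · exact inv_lt_one_of_one_lt₀ (by linarith [h1.1])
    · rw [Function.iterate_succ_apply, gaussBranch, gaussMap, inv_inv, Int.fract_natCast_add,
        Int.fract_eq_self.2 ⟨h1.1.le, h1.2⟩, h2]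

/-- The inverse branches of the iterates of the Gauss map are the Möbius transformations given by
consecutive convergents. -/
theorem exists_gaussBranch_eq {x : ℝ} (hx : Irrational x) (hx1 : x ∈ Set.Ioo (0 : ℝ) 1) (n : ℕ) :
    -- Here p/q is the n-th convergent and p', q' are its predecessor's numerator and denominator.
    -- The third inequality keeps `q' ≤ q` inductive; `p ≤ q` with the fourth makes q grow at least
    -- linearly. The last identity expresses q through the orbit.
    ∃ p p' q q' : ℕ, p ≤ q ∧ q' ≤ q ∧ p' + q' ≤ p + q ∧ n + 1 ≤ p + q ∧
      ((p' : ℝ) * q - p * q') ^ 2 = 1 ∧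
      (∀ t : ℝ, 0 ≤ t → gaussBranch n x t = (p + t * p') / (q + t * q')) ∧
      x.convergent n = p / q ∧
      (∏ i ∈ Finset.range n, gaussMap^[i] x) * (q + gaussMap^[n] x * q') = 1 := by
  induction n generalizing x with
  | zero =>
    refine ⟨0, 1, 1, 0, by simp, by simp, by simp, by simp, by simp, by simp [gaussBranch], ?_,
      by simp⟩
    simp [Int.floor_eq_zero_iff.2 ⟨hx1.1.le, hx1.2⟩]
  | succ n ih =>
    have h := gaussMap_mem_Ioo hx
    have hy := iterate_gaussMap_mem_Ioo h.1 h.2 n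
    obtain ⟨p, p', q, q', h1, h2, h3, h4, h5, h6, h7, h8⟩ := ih h.1 h.2
    have ha := one_le_floor_inv hx1
    have hq : 0 < q := by omega
    have hq' : (0 : ℝ) < q := by exact_mod_cast hq
    have key := gaussBranch_iterate hx hx1 (n + 1)
    have hx0 := hx1.1
    rw [gaussBranch, Function.iterate_succ_apply, h6 _ hy.2.1.le] at key
    set a := ⌊x⁻¹⌋₊
    have hax : a * q ≥ q := Nat.le_mul_of_pos_left q ha
    -- Prepending the digit `a` replaces the branch value (p+tp')/(q+tq') by the inverse of its sum
    -- with `a`.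
    refine ⟨q, q', a * q + p, a * q' + p', by omega, ?_, ?_, by omega, ?_, ?_, ?_, ?_⟩
    · nlinarith [Nat.mul_le_mul_left (a - 1) h2, Nat.sub_add_cancel ha]
    · nlinarith [Nat.mul_le_mul_left a h2]
    · push_cast
      linear_combination h5
    · intro t ht
      have : 0 < q + t * q' := by positivity
      have e : (a : ℝ) + (p + t * p') / (q + t * q') =
          ((a * q + p) + t * (a * q' + p')) / (q + t * q') := by
        field_simp
        ring
      rw [gaussBranch, h6 t ht, e, inv_div]
      push_cast
      rfl
    · have : (0 : ℚ) < q := by exact_mod_cast hq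
      have e : (⌊x⁻¹⌋₊ : ℚ) + p / q = (a * q + p) / q := by
        rw [add_div, mul_div_cancel_right₀ _ this.ne']
      rw [convergent_succ_eq_inv hx1, h7, e, inv_div]
      push_cast
      rfl
    · rw [Finset.prod_range_succ']
      simp only [Function.iterate_succ_apply, Function.iterate_zero, id]
      set y := gaussMap^[n] (gaussMap x)
      have hden : 0 < q + y * q' := by
        have := hy.2.1
        positivity
      have hxe : x * (a * (q + y * q') + (p + y * p')) = q + y * q' := by
        have hpos : (a : ℝ) + (p + y * p') / (q + y * q') ≠ 0 := fun h0 => by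
          rw [h0, inv_zero] at key
          exact hx0.ne key
        have e : (a : ℝ) + (p + y * p') / (q + y * q') = x⁻¹ := by rw [← key, inv_inv]
        field_simp at e
        linear_combination e
      push_cast
      linear_combination (∏ i ∈ Finset.range n, gaussMap^[i] (gaussMap x)) * hxe + h8

/-- The squared determinant identity is a Bézout relation for p and q. -/
theorem den_div_eq {p p' q q' : ℕ} (hq : 0 < q) (h : ((p' : ℝ) * q - p * q') ^ 2 = 1) :
    ((p : ℚ) / q).den = q := by
  have hc : IsCoprime (p : ℤ) q := by
    have h' : ((p' : ℤ) * q - p * q') ^ 2 = 1 := by exact_mod_cast h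
    exact ⟨-(p' * q - p * q') * q', (p' * q - p * q') * p', by linear_combination h'⟩
  have := Rat.den_div_eq_of_coprime (a := p) (b := q) (by exact_mod_cast hq)
    (Nat.isCoprime_iff_coprime.1 hc)
  rw [Int.cast_natCast, Int.cast_natCast] at this
  exact Int.natCast_inj.1 this

/-! ### Ergodicity of the Gauss map by Lebesgue density. -/

/-- Every cylinder is an interval in which a set `A` invariant under the Gauss map has relative
measure at least half the measure of `A ∩ (0, 1)`. -/
theorem exists_closedBall_cylinder {x : ℝ} (hx : Irrational x) (hx1 : x ∈ Set.Ioo (0 : ℝ) 1)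
    {A : Set ℝ} (hA : MeasurableSet A) (hTA : gaussMap ⁻¹' A = A) (n : ℕ) :
    ∃ w δ : ℝ, 0 < δ ∧ δ ≤ 2 / (n + 1) ∧ x ∈ Metric.closedBall w δ ∧
      volume (A ∩ Set.Ioo 0 1) / 2 * volume (Metric.closedBall w δ) ≤
        volume (A ∩ Metric.closedBall w δ) := by
  obtain ⟨p, p', q, q', h1, h2, h3, h4, h5, h6, -, -⟩ := exists_gaussBranch_eq hx hx1 n
  have hq : 0 < q := by omega
  have hq0 : (0 : ℝ) < q := by exact_mod_cast hq
  have hq1 : (1 : ℝ) ≤ q := by exact_mod_cast hq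
  have hq2 : (q' : ℝ) ≤ q := by exact_mod_cast h2
  have hqn : (n : ℝ) + 1 ≤ 2 * q := by exact_mod_cast (by omega : n + 1 ≤ 2 * q)
  have hqq : (0 : ℝ) < q + q' := by positivity
  set D : ℝ := p' * q - p * q' with hD
  have hDabs : |D| = 1 := by
    rwa [← sq_abs, pow_eq_one_iff_of_nonneg (abs_nonneg _) two_ne_zero] at h5
  -- The signed length of the cylinder, from the branch value p/q at t = 0 to (p+p')/(q+q') at t =
  -- 1; the ball below has these endpoints.
  set d : ℝ := D / (q * (q + q')) with hd
  have hdabs : |d| = 1 / (q * (q + q')) := by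
    rw [hd, abs_div, hDabs, abs_of_pos (by positivity)]
  have hball : ∀ t ∈ Set.Ioo (0 : ℝ) 1,
      gaussBranch n x t ∈ Metric.closedBall (p / q + d / 2) (|d| / 2) := fun t ht => by
    have ht0 := ht.1
    have hpos : (0 : ℝ) < q + t * q' := by positivity
    have e : gaussBranch n x t - (p / q + d / 2) = (t * (q + q') / (q + t * q') - 1 / 2) * d := by
      rw [h6 t ht.1.le, hd, hD]
      field_simp
      ring
    have hs0 : 0 ≤ t * (q + q') / (q + t * q') := by positivity
    have hs1 : t * (q + q') / (q + t * q') ≤ 1 := by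
      rw [div_le_one hpos]
      nlinarith [ht.2]
    rw [Metric.mem_closedBall, Real.dist_eq, e, abs_mul, div_eq_inv_mul |d|]
    refine mul_le_mul_of_nonneg_right ?_ (abs_nonneg d)
    rw [abs_le]
    constructor <;> linarith
  refine ⟨p / q + d / 2, |d| / 2, ?_, ?_, ?_, ?_⟩
  · rw [hdabs]
    positivity
  · rw [hdabs, div_div, div_le_div_iff₀ (by positivity) (by positivity)]
    nlinarith [mul_nonneg hq0.le (Nat.cast_nonneg (α := ℝ) q')]
  · have := hball _ (iterate_gaussMap_mem_Ioo hx hx1 n).2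
    rwa [gaussBranch_iterate hx hx1] at this
  · set E := A ∩ Set.Ioo (0 : ℝ) 1
    have hE : MeasurableSet E := hA.inter measurableSet_Ioo
    have hsub : gaussBranch n x '' E ⊆ A ∩ Metric.closedBall (p / q + d / 2) (|d| / 2) := by
      rintro _ ⟨t, ht, rfl⟩
      refine ⟨?_, hball t ht.2⟩
      have h := (iterate_gaussBranch hx hx1 n ht.2).2
      have hA' : gaussMap^[n] ⁻¹' A = A := Set.preimage_iterate_eq ▸ Function.iterate_fixed hTA n
      rw [← hA', Set.mem_preimage, h]
      exact ht.1
    have hinj : Set.InjOn (gaussBranch n x) E := fun s hs t ht hst => by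
      rw [← (iterate_gaussBranch hx hx1 n hs.2).2, hst, (iterate_gaussBranch hx hx1 n ht.2).2]
    have hderiv : ∀ t ∈ E, HasDerivWithinAt (gaussBranch n x) (D / (q + t * q') ^ 2) E t := by
      intro t ht
      have ht0 := ht.2.1
      have hpos : (0 : ℝ) < q + t * q' := by positivity
      have := (((hasDerivAt_id t).mul_const (p' : ℝ)).const_add (p : ℝ)).div
        (((hasDerivAt_id t).mul_const (q' : ℝ)).const_add (q : ℝ)) hpos.ne'
      refine (this.congr_deriv ?_).hasDerivWithinAt.congr (fun s hs => h6 s hs.2.1.le)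
        (h6 t ht.2.1.le)
      simp only [id, hD]
      congr 1
      ring
    have himg := lintegral_image_eq_lintegral_abs_deriv_mul hE hderiv hinj 1
    simp only [Pi.one_apply, lintegral_one, Measure.restrict_apply_univ, mul_one] at himg
    refine le_trans ?_ (measure_mono hsub)
    rw [himg]
    -- The branch has derivative at least 1/(q+q')² in absolute value, and q' ≤ q makes this at
    -- least half the cylinder length 1/(q(q+q')).
    have hle : ∫⁻ _ in E, ENNReal.ofReal (1 / (q + q') ^ 2) ≤
        ∫⁻ t in E, ENNReal.ofReal |D / (q + t * q') ^ 2| := by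
      refine setLIntegral_mono' hE fun t ht => ENNReal.ofReal_le_ofReal ?_
      have ht0 := ht.2.1
      have hpos : (0 : ℝ) < q + t * q' := by positivity
      rw [abs_div, hDabs, abs_of_pos (by positivity : 0 < ((q : ℝ) + t * q') ^ 2)]
      have : t * (q' : ℝ) ≤ q' := mul_le_of_le_one_left (Nat.cast_nonneg _) ht.2.2.le
      gcongr
    refine le_trans ?_ hle
    rw [setLIntegral_const, Real.volume_closedBall, mul_div_cancel₀ _ two_ne_zero, hdabs, mul_comm,
      ← mul_div_assoc, ENNReal.div_eq_inv_mul, ← mul_assoc]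
    gcongr
    rw [show (2 : ENNReal)⁻¹ = ENNReal.ofReal (1 / 2) by
      rw [one_div, ENNReal.ofReal_inv_of_pos two_pos, ENNReal.ofReal_ofNat], ← ENNReal.ofReal_mul (by norm_num)]
    refine ENNReal.ofReal_le_ofReal ?_
    rw [div_mul_div_comm, one_mul, div_le_div_iff₀ (by positivity) (by positivity)]
    nlinarith

theorem ae_irrational : ∀ᵐ x : ℝ, Irrational x := by
  have := (Set.countable_range ((↑) : ℚ → ℝ)).ae_notMem volume
  exact this

/-- Suppose an invariant `A` has positive measure in (0,1). At a density point of its complement,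
the share of `A` in shrinking cylinders would tend to 0, yet it is bounded below by half that
measure. -/
theorem preErgodic_gaussMap : PreErgodic gaussMap gaussMeasure := by
  refine ⟨fun A hA hTA => ?_⟩
  rw [eventuallyConst_set]
  rcases eq_or_ne (volume (A ∩ Set.Ioo 0 1)) 0 with h0 | h0
  · right
    have h1 : ∀ᵐ x : ℝ, x ∉ A ∩ Set.Ioo (0 : ℝ) 1 := measure_eq_zero_iff_ae_notMem.1 h0
    have h2 : ∀ᵐ x ∂volume.restrict (Set.Ioc (0 : ℝ) 1), x ∉ A := by
      rw [← restrict_Ioo_eq_restrict_Ioc, ae_restrict_iff' measurableSet_Ioo]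
      filter_upwards [h1] with x hx hx1 hxA using hx ⟨hxA, hx1⟩
    exact gaussMeasure_absolutelyContinuous.ae_le h2
  · left
    -- With the constant 1, the balls need only contain the point and need not be centred at it, as
    -- suits cylinders.
    have hdens := IsUnifLocDoublingMeasure.ae_tendsto_measure_inter_div (volume : Measure ℝ) Aᶜ 1
    rw [ae_restrict_iff' hA.compl] at hdens
    have h2 : ∀ᵐ x ∂volume.restrict (Set.Ioc (0 : ℝ) 1), x ∈ A := by
      rw [← restrict_Ioo_eq_restrict_Ioc, ae_restrict_iff' measurableSet_Ioo]
      filter_upwards [hdens, ae_irrational] with x hx hxi hx1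
      by_contra hxA
      choose w δ hδ0 hδ1 hmem hvol using exists_closedBall_cylinder hxi hx1 hA hTA
      have hδ : Tendsto δ atTop (𝓝[>] 0) := by
        refine tendsto_nhdsWithin_iff.2 ⟨?_, Eventually.of_forall hδ0⟩
        refine squeeze_zero (fun n => (hδ0 n).le) hδ1 ?_
        exact tendsto_const_nhds.div_atTop
          (tendsto_natCast_atTop_atTop.atTop_add tendsto_const_nhds)
      have hlim := hx hxA w δ hδ (Eventually.of_forall fun n => by rw [one_mul]; exact hmem n)
      have hc : volume (A ∩ Set.Ioo 0 1) / 2 ≠ 0 := ENNReal.div_ne_zero.2 ⟨h0, by simp⟩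
      have hbound : ∀ n, volume (Aᶜ ∩ Metric.closedBall (w n) (δ n)) /
          volume (Metric.closedBall (w n) (δ n)) ≤ 1 - volume (A ∩ Set.Ioo 0 1) / 2 := by
        intro n
        set B := Metric.closedBall (w n) (δ n)
        have hB0 : volume B ≠ 0 := (Metric.measure_closedBall_pos _ _ (hδ0 n)).ne'
        have hBt : volume B ≠ ⊤ := measure_closedBall_lt_top.ne
        have hsum : volume (A ∩ B) + volume (Aᶜ ∩ B) = volume B := by
          rw [Set.inter_comm A, Set.inter_comm Aᶜ]
          exact measure_inter_add_sdiff B hA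
        have hfin : volume (A ∩ Set.Ioo 0 1) / 2 ≠ ⊤ := by
          refine (ENNReal.div_lt_top ?_ two_ne_zero).ne
          exact ((measure_mono Set.inter_subset_right).trans_lt measure_Ioo_lt_top).ne
        refine ENNReal.le_sub_of_add_le_left hfin ?_
        calc _ ≤ volume (A ∩ B) / volume B + volume (Aᶜ ∩ B) / volume B := by
              refine add_le_add ?_ le_rfl
              rw [ENNReal.le_div_iff_mul_le (Or.inl hB0) (Or.inl hBt)]
              exact hvol n
          _ = 1 := by rw [← ENNReal.add_div, hsum, ENNReal.div_self hB0 hBt]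
      have := le_of_tendsto' hlim hbound
      exact not_lt.2 this (ENNReal.sub_lt_self ENNReal.one_ne_top one_ne_zero hc)
    exact gaussMeasure_absolutelyContinuous.ae_le h2

theorem ergodic_gaussMap : Ergodic gaussMap gaussMeasure :=
  ⟨measurePreserving_gaussMap, preErgodic_gaussMap⟩

/-! ### Lévy's constant: the integral of -log x. -/

theorem intervalIntegrable_pow_mul_neg_log (n : ℕ) :
    IntervalIntegrable (fun x : ℝ => x ^ n * -Real.log x) volume 0 1 :=
  intervalIntegral.intervalIntegrable_log'.neg.continuousOn_mul (by fun_prop)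

theorem integral_pow_mul_neg_log (n : ℕ) :
    ∫ x in (0 : ℝ)..1, x ^ n * -Real.log x = 1 / ((n : ℝ) + 1) ^ 2 := by
  have hn : (n : ℝ) + 1 ≠ 0 := by positivity
  rw [intervalIntegral.integral_eq_sub_of_hasDerivAt_of_le zero_le_one
    -- Grouping x · log x makes the antiderivative visibly continuous at 0.
    (f := fun x => x ^ n * (x * Real.log x) * (-1 / (n + 1)) + x ^ (n + 1) / (n + 1) ^ 2)]
  · simp
  · have := Real.continuous_mul_log
    fun_prop
  · intro x hx
    have h1 := ((hasDerivAt_pow n x).mul ((hasDerivAt_id x).mul (Real.hasDerivAt_log hx.1.ne'))).mul_const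
      (-1 / ((n : ℝ) + 1))
    have h2 := (hasDerivAt_pow (n + 1) x).div_const (((n : ℝ) + 1) ^ 2)
    refine (h1.add h2).congr_deriv ?_
    have hx0 := hx.1.ne'
    rcases n with _ | n
    · simp
      field_simp
      ring
    · simp
      field_simp
      ring
  · exact intervalIntegrable_pow_mul_neg_log n

/-- `∑ (-1)ⁿ / (n + 1)² = π² / 12`. -/
theorem hasSum_alternating_inv_sq :
    HasSum (fun n : ℕ => (-1 : ℝ) ^ n * (1 / ((n : ℝ) + 1) ^ 2)) (Real.pi ^ 2 / 12) := by
  have hz := hasSum_zeta_two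
  have h2 : HasSum (fun n : ℕ => if Even n then (1 : ℝ) / (n : ℝ) ^ 2 else 0)
      (1 / 4 * (Real.pi ^ 2 / 6)) := by
    have hinj : Function.Injective fun k : ℕ => 2 * k := fun a b h => by simpa using h
    rw [← hinj.hasSum_iff]
    · refine (hz.mul_left (1 / 4)).congr_fun ?_
      intro k
      simp only [Function.comp, even_two_mul, if_true]
      push_cast
      rw [mul_pow, div_mul_div_comm]
      norm_num
    · intro n hn
      refine if_neg fun he => hn ?_
      obtain ⟨k, hk⟩ := he
      exact ⟨k, by simp only; omega⟩
  -- Subtracting the even terms twice flips their signs; the index shift that follows drops the zero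
  -- term at n = 0.
  have h3 := hz.sub (h2.mul_left 2)
  have h4 := (hasSum_nat_add_iff' 1).2 h3
  simp only [Finset.sum_range_one] at h4
  have e : Real.pi ^ 2 / 12 = Real.pi ^ 2 / 6 - 2 * (1 / 4 * (Real.pi ^ 2 / 6)) -
      (1 / ((0 : ℕ) : ℝ) ^ 2 - 2 * if Even 0 then 1 / ((0 : ℕ) : ℝ) ^ 2 else 0) := by
    norm_num
    ring
  rw [e]
  refine h4.congr_fun fun n => ?_
  rcases Nat.even_or_odd n with he | ho
  · rw [he.neg_one_pow, if_neg (by simpa [Nat.even_add_one] using he)]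
    push_cast
    ring
  · rw [ho.neg_one_pow, if_pos (by simpa [Nat.even_add_one] using ho)]
    push_cast
    ring

theorem integral_gaussMeasure (f : ℝ → ℝ) :
    ∫ x, f x ∂gaussMeasure = ∫ x in Set.Ioc 0 1, gaussDensity x * f x := by
  rw [gaussMeasure, integral_withDensity_eq_integral_toReal_smul
    measurable_gaussDensity.ennreal_ofReal (ae_of_all _ fun x => ENNReal.ofReal_lt_top)]
  refine setIntegral_congr_fun measurableSet_Ioc fun x hx => ?_
  simp only [smul_eq_mul, ENNReal.toReal_ofReal (gaussDensity_pos hx.1.le).le]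

theorem integrable_neg_log_gaussMeasure : Integrable (fun x => -Real.log x) gaussMeasure := by
  have hle : gaussMeasure ≤ ENNReal.ofReal (Real.log 2)⁻¹ • volume.restrict (Set.Ioc 0 1) := by
    rw [gaussMeasure, ← withDensity_const]
    refine withDensity_mono ?_
    filter_upwards [ae_restrict_mem measurableSet_Ioc] with x hx
    refine ENNReal.ofReal_le_ofReal (inv_anti₀ (Real.log_pos one_lt_two) ?_)
    nlinarith [Real.log_pos one_lt_two, hx.1]
  refine Integrable.mono_measure (Integrable.smul_measure ?_ ENNReal.ofReal_ne_top) hle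
  exact (intervalIntegrable_iff_integrableOn_Ioc_of_le zero_le_one).1
    intervalIntegral.intervalIntegrable_log'.neg

/-- Expand 1/(1+x) as a geometric series and integrate termwise; the norms have summable integrals
1/(n+1)². -/
theorem integral_neg_log_gaussMeasure :
    ∫ x, -Real.log x ∂gaussMeasure = Real.pi ^ 2 / (12 * Real.log 2) := by
  have hint : ∀ n : ℕ, Integrable (fun x : ℝ => (-1) ^ n * (x ^ n * -Real.log x))
      (volume.restrict (Set.Ioc 0 1)) := fun n =>
    ((intervalIntegrable_iff_integrableOn_Ioc_of_le zero_le_one).1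
      (intervalIntegrable_pow_mul_neg_log n)).const_mul _
  have hval : ∀ n : ℕ, ∫ x in Set.Ioc (0 : ℝ) 1, x ^ n * -Real.log x = 1 / ((n : ℝ) + 1) ^ 2 :=
    fun n => by rw [← intervalIntegral.integral_of_le zero_le_one, integral_pow_mul_neg_log]
  have hnorm : ∀ n : ℕ, ∫ x in Set.Ioc (0 : ℝ) 1, ‖(-1) ^ n * (x ^ n * -Real.log x)‖ =
      1 / ((n : ℝ) + 1) ^ 2 := fun n => by
    rw [← hval]
    refine setIntegral_congr_fun measurableSet_Ioc fun x hx => ?_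
    have hx0 := hx.1
    have : 0 ≤ x ^ n * -Real.log x :=
      mul_nonneg (by positivity) (neg_nonneg.2 (Real.log_nonpos hx.1.le hx.2))
    simp only [norm_mul, norm_pow, norm_neg, norm_one, one_pow, one_mul]
    rw [← norm_neg (Real.log x), ← norm_pow, ← norm_mul, Real.norm_of_nonneg this]
  have hsummable : Summable fun n : ℕ => 1 / ((n : ℝ) + 1) ^ 2 := by
    exact_mod_cast (summable_nat_add_iff 1).2 hasSum_zeta_two.summable
  have key := hasSum_integral_of_summable_integral_norm hint (by simpa only [hnorm] using hsummable)
  simp only [integral_const_mul, hval] at key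
  have h := key.unique hasSum_alternating_inv_sq
  have hlog := Real.log_pos one_lt_two
  rw [integral_gaussMeasure, ← mul_right_inj' hlog.ne', ← integral_const_mul]
  trans Real.pi ^ 2 / 12
  -- The endpoint 1 is removed because the geometric series diverges there.
  · rw [← h, ← restrict_Ioo_eq_restrict_Ioc]
    refine setIntegral_congr_fun measurableSet_Ioo fun x hx => ?_
    have hx0 := hx.1
    have hg : HasSum (fun n : ℕ => (-1) ^ n * (x ^ n * -Real.log x)) ((1 - -x)⁻¹ * -Real.log x) := by
      have := (hasSum_geometric_of_abs_lt_one (r := -x)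
        (by rw [abs_neg, abs_of_pos hx0]; exact hx.2)).mul_right (-Real.log x)
      refine this.congr_fun fun n => ?_
      rw [neg_pow]
      ring
    simp only [hg.tsum_eq, gaussDensity, sub_neg_eq_add]
    field_simp
  · field_simp

/-! ### Khinchin's constant: the integral of the logarithm of the first digit. -/

theorem log_floor_inv_le {x : ℝ} (hx : x ∈ Set.Ioc (0 : ℝ) 1) :
    Real.log ⌊x⁻¹⌋₊ ≤ -Real.log x := by
  rw [← Real.log_inv]
  have h1 : 1 ≤ ⌊x⁻¹⌋₊ := Nat.le_floor (by simpa using (one_le_inv₀ hx.1).2 hx.2)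
  exact Real.log_le_log (by exact_mod_cast h1) (Nat.floor_le (inv_nonneg.2 hx.1.le))

theorem measurable_log_floor_inv : Measurable fun x : ℝ => Real.log ⌊x⁻¹⌋₊ := by
  fun_prop

theorem integrable_log_floor_inv : Integrable (fun x : ℝ => Real.log ⌊x⁻¹⌋₊) gaussMeasure := by
  refine integrable_neg_log_gaussMeasure.mono' measurable_log_floor_inv.aestronglyMeasurable ?_
  filter_upwards [ae_gaussMeasure_mem_Ioc] with x hx
  rw [Real.norm_of_nonneg (Real.log_natCast_nonneg _)]
  exact log_floor_inv_le hx

theorem floor_inv_eq_iff {x : ℝ} (hx : 0 < x) (k : ℕ) :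
    ⌊x⁻¹⌋₊ = k + 1 ↔ x ∈ Set.Ioc ((k : ℝ) + 2)⁻¹ ((k : ℝ) + 1)⁻¹ := by
  rw [Nat.floor_eq_iff (inv_nonneg.2 hx.le), Set.mem_Ioc, inv_lt_comm₀ (by positivity) hx,
    le_inv_comm₀ hx (by positivity), and_comm]
  push_cast
  rw [show (k : ℝ) + 1 + 1 = k + 2 by ring]

/-- On the cylinder of first digit k+1 the integrand is constant, and the second factor is the
cylinder's Gauss measure. -/
theorem hasSum_integral_log_floor_inv :
    HasSum (fun k : ℕ => Real.log ((k : ℝ) + 1) *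
      (Real.log (1 + (((k : ℝ) + 1) * ((k : ℝ) + 3))⁻¹) / Real.log 2))
      (∫ x : ℝ, Real.log ⌊x⁻¹⌋₊ ∂gaussMeasure) := by
  let s : ℕ → Set ℝ := fun k => Set.Ioc ((k : ℝ) + 2)⁻¹ ((k : ℝ) + 1)⁻¹
  have hpos : ∀ k x, x ∈ s k → 0 < x := fun k x hx => lt_trans (by positivity) hx.1
  have hU : ⋃ k, s k = Set.Ioc 0 1 := by
    ext x
    rw [Set.mem_iUnion]
    constructor
    · rintro ⟨k, hk⟩
      exact ⟨hpos k x hk, hk.2.trans (inv_le_one_of_one_le₀ (by simp))⟩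
    · intro hx
      have h1 : 1 ≤ ⌊x⁻¹⌋₊ := Nat.le_floor (by simpa using (one_le_inv₀ hx.1).2 hx.2)
      exact ⟨⌊x⁻¹⌋₊ - 1, (floor_inv_eq_iff hx.1 _).1 (by omega)⟩
  have hd : Pairwise (Function.onFun Disjoint s) := fun i j hij =>
    Set.disjoint_left.2 fun x hi hj => hij (by
      have h1 := (floor_inv_eq_iff (hpos i x hi) i).2 hi
      have h2 := (floor_inv_eq_iff (hpos i x hi) j).2 hj
      omega)
  have key := hasSum_integral_iUnion (μ := gaussMeasure) (fun k => measurableSet_Ioc) hd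
    integrable_log_floor_inv.integrableOn
  have hfull : ∫ x in ⋃ k, s k, Real.log ⌊x⁻¹⌋₊ ∂gaussMeasure =
      ∫ x, Real.log ⌊x⁻¹⌋₊ ∂gaussMeasure := by
    rw [hU, Measure.restrict_eq_self_of_ae_mem ae_gaussMeasure_mem_Ioc]
  rw [hfull] at key
  refine key.congr_fun fun k => ?_
  have h1 : ∫ x in s k, Real.log ⌊x⁻¹⌋₊ ∂gaussMeasure =
      ∫ x in s k, Real.log ((k : ℝ) + 1) ∂gaussMeasure :=
    setIntegral_congr_fun measurableSet_Ioc fun x hx => by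
      simp only [(floor_inv_eq_iff (hpos k x hx) k).2 hx]
      push_cast
      rfl
  rw [h1, setIntegral_const, smul_eq_mul, mul_comm]
  congr 1
  have h2 := Real.log_pos one_lt_two
  have hle : ((k : ℝ) + 2)⁻¹ ≤ ((k : ℝ) + 1)⁻¹ := inv_anti₀ (by positivity) (by linarith)
  have h3 : Real.log (1 + ((k : ℝ) + 1)⁻¹) - Real.log (1 + ((k : ℝ) + 2)⁻¹) =
      Real.log (1 + (((k : ℝ) + 1) * ((k : ℝ) + 3))⁻¹) := by
    rw [← Real.log_div (by positivity) (by positivity)]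
    congr 1
    field_simp
    ring
  rw [Measure.real, gaussMeasure_Ioc (by positivity) hle (inv_le_one_of_one_le₀ (by simp)), h3,
    ENNReal.toReal_ofReal]
  exact div_nonneg (Real.log_nonneg (le_add_of_nonneg_right (by positivity))) h2.le

theorem khinchinFactor_succPNat (k : ℕ) :
    ContFracScaling.khinchinFactor k.succPNat =
      Real.exp (Real.log ((k : ℝ) + 1) *
        (Real.log (1 + (((k : ℝ) + 1) * ((k : ℝ) + 3))⁻¹) / Real.log 2)) := by
  have e : ((k.succPNat : ℕ+) : ℝ) = (k : ℝ) + 1 := by simp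
  rw [ContFracScaling.khinchinFactor, e, Real.rpow_def_of_pos (by positivity)]
  congr 1
  rw [show (k : ℝ) + 1 + 2 = k + 3 by ring]
  ring

theorem hasProd_khinchinFactor :
    HasProd ContFracScaling.khinchinFactor
      (Real.exp (∫ x : ℝ, Real.log ⌊x⁻¹⌋₊ ∂gaussMeasure)) := by
  rw [← Equiv.pnatEquivNat.symm.hasProd_iff]
  convert hasSum_integral_log_floor_inv.rexp using 1
  exact funext khinchinFactor_succPNat

theorem log_khinchin :
    Real.log ContFracScaling.khinchin = ∫ x : ℝ, Real.log ⌊x⁻¹⌋₊ ∂gaussMeasure := by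
  rw [ContFracScaling.khinchin, hasProd_khinchinFactor.tprod_eq, Real.log_exp]

/-! ### Numerical bounds for α₀. -/

/-- The logarithm of the ratio of consecutive integers, `log ((k + 2) / (k + 1))`. -/
def logGap (k : ℕ) : ℝ := Real.log ((k : ℝ) + 2) - Real.log ((k : ℝ) + 1)

/-- This is 2 artanh(1/(2k+3)), whose power series converges quickly. -/
theorem logGap_eq (k : ℕ) :
    logGap k = 2 * (1 / 2 * Real.log ((1 + (2 * (k : ℝ) + 3)⁻¹) / (1 - (2 * (k : ℝ) + 3)⁻¹))) := by
  rw [logGap, ← Real.log_div (by positivity) (by positivity), ← mul_assoc]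
  norm_num only [one_mul]
  congr 1
  have h1 : (2 * (k : ℝ) + 3) ≠ 0 := by positivity
  have h2 : 1 - (2 * (k : ℝ) + 3)⁻¹ = 2 * (k + 1) / (2 * k + 3) := by
    field_simp
    ring
  have h3 : 1 + (2 * (k : ℝ) + 3)⁻¹ = 2 * (k + 2) / (2 * k + 3) := by
    field_simp
    ring
  rw [h2, h3]
  field_simp

theorem inv_two_mul_add_three_lt_one (k : ℕ) : (2 * (k : ℝ) + 3)⁻¹ < 1 :=
  inv_lt_one_of_one_lt₀ (by linarith [(Nat.cast_nonneg k : (0 : ℝ) ≤ k)])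

theorem sum_le_logGap (n k : ℕ) :
    2 * ∑ i ∈ Finset.range n, (2 * (k : ℝ) + 3)⁻¹ ^ (2 * i + 1) / (2 * i + 1) ≤ logGap k := by
  rw [logGap_eq]
  have := Real.sum_range_le_log_div (x := (2 * (k : ℝ) + 3)⁻¹) (by positivity)
    (inv_two_mul_add_three_lt_one k) n
  gcongr

theorem logGap_le_sum_add (n k : ℕ) :
    logGap k ≤ 2 * ((∑ i ∈ Finset.range n, (2 * (k : ℝ) + 3)⁻¹ ^ (2 * i + 1) / (2 * i + 1)) +
      (2 * (k : ℝ) + 3)⁻¹ ^ (2 * n + 1) / (1 - (2 * (k : ℝ) + 3)⁻¹ ^ 2)) := by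
  rw [logGap_eq]
  have := Real.log_div_le_sum_range_add (x := (2 * (k : ℝ) + 3)⁻¹) (by positivity)
    (inv_two_mul_add_three_lt_one k) n
  gcongr

theorem inv_add_half_le_logGap (k : ℕ) : ((k : ℝ) + 3 / 2)⁻¹ ≤ logGap k := by
  refine le_of_eq_of_le ?_ (sum_le_logGap 1 k)
  simp
  field_simp

theorem logGap_le_trapezoid (k : ℕ) :
    logGap k ≤ (2 * k + 3) / (2 * (k + 1) * (k + 2)) := by
  refine (logGap_le_sum_add 0 k).trans_eq ?_
  have h : 1 - (2 * (k : ℝ) + 3)⁻¹ ^ 2 = 4 * (k + 1) * (k + 2) / (2 * k + 3) ^ 2 := by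
    field_simp
    ring
  rw [h]
  simp
  field_simp
  ring

theorem logGap_nonneg (k : ℕ) : 0 ≤ logGap k :=
  (by positivity : (0 : ℝ) ≤ ((k : ℝ) + 3 / 2)⁻¹).trans (inv_add_half_le_logGap k)

/-- Summation by parts trades terms of order (log k)/k² for terms of order 1/k², whose tails are
easy to enclose. -/
theorem sum_log_mul_logGap_sub (N : ℕ) :
    ∑ k ∈ Finset.range N, Real.log ((k : ℝ) + 1) * (logGap k - logGap (k + 1)) =
      ∑ k ∈ Finset.range N, logGap k * logGap (k + 1) - Real.log ((N : ℝ) + 1) * logGap N := by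
  induction N with
  | zero => simp
  | succ N ih =>
    rw [Finset.sum_range_succ, Finset.sum_range_succ, ih]
    push_cast
    have : Real.log ((N : ℝ) + 1 + 1) = Real.log ((N : ℝ) + 1) + logGap N := by
      rw [logGap, show (N : ℝ) + 1 + 1 = N + 2 by ring]
      ring
    rw [this]
    ring

theorem tendsto_log_mul_logGap :
    Tendsto (fun N : ℕ => Real.log ((N : ℝ) + 1) * logGap N) atTop (𝓝 0) := by
  have h1 : Tendsto (fun N : ℕ => 2 * (Real.log ((N : ℝ) + 1) / ((N : ℝ) + 1))) atTop (𝓝 (2 * 0)) := by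
    have := Real.isLittleO_log_id_atTop.tendsto_div_nhds_zero
    exact (this.comp (tendsto_natCast_atTop_atTop.atTop_add tendsto_const_nhds)).const_mul 2
  rw [mul_zero] at h1
  refine squeeze_zero (fun N => mul_nonneg (Real.log_nonneg (by simp)) (logGap_nonneg N))
    (fun N => ?_) h1
  have h2 : logGap N ≤ 2 / ((N : ℝ) + 1) := by
    refine (logGap_le_trapezoid N).trans ?_
    rw [div_le_div_iff₀ (by positivity) (by positivity)]
    nlinarith [(Nat.cast_nonneg N : (0 : ℝ) ≤ N)]
  have h3 : 0 ≤ Real.log ((N : ℝ) + 1) := Real.log_nonneg (by simp)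
  calc _ ≤ Real.log ((N : ℝ) + 1) * (2 / ((N : ℝ) + 1)) := by gcongr
    _ = _ := by ring

theorem log_one_add_inv_eq_logGap_sub (k : ℕ) :
    Real.log (1 + (((k : ℝ) + 1) * ((k : ℝ) + 3))⁻¹) = logGap k - logGap (k + 1) := by
  have h : 1 + (((k : ℝ) + 1) * ((k : ℝ) + 3))⁻¹ =
      (((k : ℝ) + 2) / (k + 1)) / ((k + 3) / (k + 2)) := by
    field_simp
    ring
  rw [h, Real.log_div (by positivity) (by positivity), Real.log_div (by positivity) (by positivity),
    Real.log_div (by positivity) (by positivity), logGap, logGap]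
  push_cast
  rw [show (k : ℝ) + 1 + 2 = k + 3 by ring, show (k : ℝ) + 1 + 1 = k + 2 by ring]

/-- `log 2 · log K₀` is the sum of the products of consecutive logarithmic gaps. -/
theorem tendsto_sum_logGap :
    Tendsto (fun N : ℕ => ∑ k ∈ Finset.range N, logGap k * logGap (k + 1)) atTop
      (𝓝 (Real.log 2 * Real.log ContFracScaling.khinchin)) := by
  have h2 := (Real.log_pos one_lt_two).ne'
  have h := (hasSum_integral_log_floor_inv.mul_left (Real.log 2)).tendsto_sum_nat
  rw [← log_khinchin] at h
  have h' := h.add tendsto_log_mul_logGap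
  rw [add_zero] at h'
  refine h'.congr fun N => ?_
  rw [sub_eq_iff_eq_add.1 (sum_log_mul_logGap_sub N).symm]
  congr 1
  refine Finset.sum_congr rfl fun k _ => ?_
  rw [log_one_add_inv_eq_logGap_sub]
  field_simp

/-- The products of the midpoint bounds telescope, so the left side increases with `N` to the limit.
-/
theorem sum_logGap_add_le (N : ℕ) :
    ∑ k ∈ Finset.range N, logGap k * logGap (k + 1) + ((N : ℝ) + 3 / 2)⁻¹ ≤
      Real.log 2 * Real.log ContFracScaling.khinchin := by
  have hlim : Tendsto (fun N : ℕ => ((N : ℝ) + 3 / 2)⁻¹) atTop (𝓝 0) :=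
    tendsto_inv_atTop_zero.comp (tendsto_natCast_atTop_atTop.atTop_add tendsto_const_nhds)
  have h := tendsto_sum_logGap.add hlim
  rw [add_zero] at h
  refine Monotone.ge_of_tendsto (monotone_nat_of_le_succ fun n => ?_) h N
  have h1 := mul_le_mul (inv_add_half_le_logGap n) (inv_add_half_le_logGap (n + 1))
    (by positivity) (logGap_nonneg n)
  have h3 : ((n : ℝ) + 3 / 2)⁻¹ * (((n + 1 : ℕ) : ℝ) + 3 / 2)⁻¹ =
      ((n : ℝ) + 3 / 2)⁻¹ - (((n + 1 : ℕ) : ℝ) + 3 / 2)⁻¹ := by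
    push_cast
    field_simp
    ring
  rw [Finset.sum_range_succ]
  linarith

theorem log_khinchin_le_sum_add {N : ℕ} (hN : 20 ≤ N) :
    Real.log 2 * Real.log ContFracScaling.khinchin ≤
      -- 89/60 is slightly below 3/2, leaving room for the products of the trapezoid bounds to be
      -- dominated by telescoping differences once n ≥ 20.
      ∑ k ∈ Finset.range N, logGap k * logGap (k + 1) + ((N : ℝ) + 89 / 60)⁻¹ := by
  have hlim : Tendsto (fun N : ℕ => ((N : ℝ) + 89 / 60)⁻¹) atTop (𝓝 0) :=
    tendsto_inv_atTop_zero.comp (tendsto_natCast_atTop_atTop.atTop_add tendsto_const_nhds)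
  have h := tendsto_sum_logGap.add hlim
  rw [add_zero] at h
  refine le_of_tendsto h ?_
  filter_upwards [eventually_ge_atTop N] with K hK
  induction K, hK using Nat.le_induction with
  | base => exact le_rfl
  | succ n hn ih =>
    refine le_trans ?_ ih
    have hn' : (20 : ℝ) ≤ n := by exact_mod_cast hN.trans hn
    have h1 := mul_le_mul (logGap_le_trapezoid n) (logGap_le_trapezoid (n + 1))
      (logGap_nonneg _) (by positivity)
    have h3 : (2 * (n : ℝ) + 3) / (2 * (n + 1) * (n + 2)) *
        ((2 * ((n + 1 : ℕ) : ℝ) + 3) / (2 * (((n + 1 : ℕ) : ℝ) + 1) * (((n + 1 : ℕ) : ℝ) + 2))) ≤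
        ((n : ℝ) + 89 / 60)⁻¹ - (((n + 1 : ℕ) : ℝ) + 89 / 60)⁻¹ := by
      push_cast
      have e : ((n : ℝ) + 89 / 60)⁻¹ - ((n : ℝ) + 1 + 89 / 60)⁻¹ =
          1 / ((n + 89 / 60) * (n + 149 / 60)) := by
        field_simp
        ring
      rw [e, div_mul_div_comm, div_le_div_iff₀ (by positivity) (by positivity)]
      -- After the shift by 20, positivity of the polynomial difference can be read off its
      -- coefficients.
      obtain ⟨m, hm⟩ : ∃ m : ℝ, (n : ℝ) = m + 20 := ⟨n - 20, by ring⟩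
      have hm0 : 0 ≤ m := by linarith
      rw [hm, ← sub_nonneg]
      ring_nf
      positivity
    rw [Finset.sum_range_succ]
    linarith

/-- This bound and the next fit between 0.8325·π²/12 ≈ 0.684704 and 0.8326·π²/12 ≈ 0.684786. -/
theorem le_log_two_mul_log_khinchin :
    0.684715 ≤ Real.log 2 * Real.log ContFracScaling.khinchin := by
  refine le_trans ?_ (sum_logGap_add_le 20)
  refine le_trans ?_ (add_le_add_left (Finset.sum_le_sum fun k _ =>
    mul_le_mul (sum_le_logGap 5 k) (sum_le_logGap 5 (k + 1)) (by positivity) (logGap_nonneg k)) _)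
  norm_num [Finset.sum_range_succ]

theorem log_two_mul_log_khinchin_le :
    Real.log 2 * Real.log ContFracScaling.khinchin ≤ 0.684775 := by
  refine (log_khinchin_le_sum_add le_rfl).trans ?_
  refine (add_le_add_left (Finset.sum_le_sum fun k _ =>
    mul_le_mul (logGap_le_sum_add 5 k) (logGap_le_sum_add 5 (k + 1)) (logGap_nonneg _)
      ((logGap_nonneg k).trans (logGap_le_sum_add 5 k))) _).trans ?_
  norm_num [Finset.sum_range_succ]

theorem alphaZero_mem_Ico :
    0.8325 ≤ ContFracScaling.alphaZero ∧ ContFracScaling.alphaZero < 0.8326 := by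
  have e : ContFracScaling.alphaZero =
      12 * (Real.log 2 * Real.log ContFracScaling.khinchin) / Real.pi ^ 2 := by
    rw [ContFracScaling.alphaZero]
    ring
  have hpi := Real.pi_pos
  have h1 : Real.pi ^ 2 ≤ 3.141593 ^ 2 := by
    gcongr
    exact Real.pi_lt_d6.le
  have h2 : (3.141592 : ℝ) ^ 2 ≤ Real.pi ^ 2 := by
    gcongr
    exact Real.pi_gt_d6.le
  have h3 := le_log_two_mul_log_khinchin
  have h4 := log_two_mul_log_khinchin_le
  rw [e, le_div_iff₀ (by positivity), div_lt_iff₀ (by positivity)]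
  constructor <;> norm_num at * <;> linarith

/-! ### Digits and denominators along the orbit, and the almost sure limit. -/

theorem digit_fract (x : ℝ) (i : ℕ) :
    ContFracScaling.digit (Int.fract x) i = ContFracScaling.digit x i := by
  have h : (GenContFract.of (Int.fract x)).s.get? i = (GenContFract.of x).s.get? i := by
    cases i with
    | zero =>
      rw [GenContFract.of_s_head_aux, GenContFract.of_s_head_aux]
      simp [GenContFract.IntFractPair.stream, GenContFract.IntFractPair.of]
    | succ i => rw [GenContFract.of_s_succ, GenContFract.of_s_succ, Int.fract_fract]
  simp only [ContFracScaling.digit, GenContFract.partDens, Stream'.Seq.map_get?, h]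

/-- The tail of the expansion of x is that of 1/x, whose digits depend only on its fractional part
`gaussMap x`. -/
theorem digit_eq_floor_inv {x : ℝ} (hx : Irrational x) (hx1 : x ∈ Set.Ioo (0 : ℝ) 1) (i : ℕ) :
    ContFracScaling.digit x i = ⌊(gaussMap^[i] x)⁻¹⌋₊ := by
  induction i generalizing x with
  | zero =>
    have hf : Int.fract x = x := Int.fract_eq_self.2 ⟨hx1.1.le, hx1.2⟩
    have h : (GenContFract.of x).s.get? 0 = some ⟨1, ⌊x⁻¹⌋⟩ := by
      have := GenContFract.of_s_head (v := x) (by rw [hf]; exact hx1.1.ne')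
      rwa [hf] at this
    simp only [ContFracScaling.digit, GenContFract.partDens, Stream'.Seq.map_get?, h]
    exact (natCast_floor_eq_intCast_floor (inv_nonneg.2 hx1.1.le)).symm
  | succ i ih =>
    have h := gaussMap_mem_Ioo hx
    have hf : Int.fract x = x := Int.fract_eq_self.2 ⟨hx1.1.le, hx1.2⟩
    rw [Function.iterate_succ_apply, ← ih h.1 h.2, gaussMap, digit_fract]
    simp only [ContFracScaling.digit, GenContFract.partDens, Stream'.Seq.map_get?,
      GenContFract.of_s_succ, hf]

theorem log_prod_digit {x : ℝ} (hx : Irrational x) (hx1 : x ∈ Set.Ioo (0 : ℝ) 1) (n : ℕ) :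
    Real.log (∏ i ∈ Finset.range n, ContFracScaling.digit x i) =
      birkhoffSum gaussMap (fun y => Real.log ⌊y⁻¹⌋₊) n x := by
  rw [Real.log_prod, birkhoffSum]
  · exact Finset.sum_congr rfl fun i _ => by rw [digit_eq_floor_inv hx hx1]
  · intro i _
    rw [digit_eq_floor_inv hx hx1]
    have := one_le_floor_inv (iterate_gaussMap_mem_Ioo hx hx1 i).2
    exact_mod_cast (by omega : ⌊(gaussMap^[i] x)⁻¹⌋₊ ≠ 0)

/-- `log q_n(x)` agrees with the Birkhoff sum of `-log` up to a bounded error. -/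
theorem log_den_mem_Icc {x : ℝ} (hx : Irrational x) (hx1 : x ∈ Set.Ioo (0 : ℝ) 1) (n : ℕ) :
    Real.log (ContFracScaling.den x n) ∈ Set.Icc
      (birkhoffSum gaussMap (fun y => -Real.log y) n x - Real.log 2)
      (birkhoffSum gaussMap (fun y => -Real.log y) n x) := by
  obtain ⟨p, p', q, q', h1, h2, h3, h4, h5, -, h7, h8⟩ := exists_gaussBranch_eq hx hx1 n
  have hq : 0 < q := by omega
  have hq0 : (0 : ℝ) < q := by exact_mod_cast hq
  have hq2 : (q' : ℝ) ≤ q := by exact_mod_cast h2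
  obtain ⟨hy0, hy1⟩ := (iterate_gaussMap_mem_Ioo hx hx1 n).2
  set y := gaussMap^[n] x
  have hpos : 0 < q + y * q' := by positivity
  have hsum : birkhoffSum gaussMap (fun y => -Real.log y) n x = Real.log (q + y * q') := by
    rw [birkhoffSum, Finset.sum_neg_distrib, ← Real.log_prod fun i _ =>
      (iterate_gaussMap_mem_Ioo hx hx1 i).2.1.ne', eq_inv_of_mul_eq_one_left h8, Real.log_inv,
      neg_neg]
  rw [hsum, ContFracScaling.den, h7, den_div_eq hq h5]
  constructor
  -- Since q' ≤ q and y < 1, the quantity q + yq' lies between q and 2q, whence the error log 2.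
  · rw [sub_le_iff_le_add, ← Real.log_mul hq0.ne' two_ne_zero]
    refine Real.log_le_log hpos ?_
    nlinarith [mul_le_of_le_one_left (Nat.cast_nonneg (α := ℝ) q') hy1.le]
  · exact Real.log_le_log hq0 (le_add_of_nonneg_right (by positivity))

/-- After division by n the error log 2 disappears, and the factors 1/n cancel in the quotient of
the two averages. -/
theorem ae_mem_levelSet_alphaZero :
    ∀ᵐ x ∂ContFracScaling.unitLebesgue, x ∈ ContFracScaling.levelSet ContFracScaling.alphaZero := by
  have h1 := ergodic_gaussMap.ae_tendsto_birkhoffAverage measurable_log_floor_inv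
    integrable_log_floor_inv
  have h2 := ergodic_gaussMap.ae_tendsto_birkhoffAverage (f := fun y => -Real.log y)
    Real.measurable_log.neg
    integrable_neg_log_gaussMeasure
  rw [integral_neg_log_gaussMeasure] at h2
  rw [← log_khinchin] at h1
  rw [ContFracScaling.unitLebesgue, ← restrict_Ioc_eq_restrict_Icc]
  filter_upwards [restrict_absolutelyContinuous_gaussMeasure.ae_le h1,
    restrict_absolutelyContinuous_gaussMeasure.ae_le h2, ae_restrict_mem measurableSet_Ioc,
    ae_restrict_of_ae ae_irrational] with x hx1 hx2 hx3 hx4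
  have hx : x ∈ Set.Ioo (0 : ℝ) 1 := ⟨hx3.1, lt_of_le_of_ne hx3.2 hx4.ne_one⟩
  refine ⟨hx, hx4, ?_⟩
  have hlog := Real.log_pos one_lt_two
  have hden : Tendsto (fun n : ℕ => (n : ℝ)⁻¹ * Real.log (ContFracScaling.den x n)) atTop
      (𝓝 (Real.pi ^ 2 / (12 * Real.log 2))) := by
    have hz : Tendsto (fun n : ℕ => (n : ℝ)⁻¹ * Real.log 2) atTop (𝓝 0) := by
      simpa using tendsto_inv_atTop_nhds_zero_nat.mul_const (Real.log 2)
    have hlow := hx2.sub hz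
    rw [sub_zero] at hlow
    refine tendsto_of_tendsto_of_tendsto_of_le_of_le hlow hx2 (fun n => ?_) fun n => ?_
    · simp only [birkhoffAverage, smul_eq_mul, ← mul_sub]
      exact mul_le_mul_of_nonneg_left (log_den_mem_Icc hx4 hx n).1 (by positivity)
    · simp only [birkhoffAverage, smul_eq_mul]
      exact mul_le_mul_of_nonneg_left (log_den_mem_Icc hx4 hx n).2 (by positivity)
  have hquot := hx1.div hden (by positivity)
  have e : Real.log ContFracScaling.khinchin / (Real.pi ^ 2 / (12 * Real.log 2)) =
      ContFracScaling.alphaZero := by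
    rw [ContFracScaling.alphaZero, div_div_eq_mul_div]
    ring
  rw [e] at hquot
  refine hquot.congr' ?_
  filter_upwards [eventually_gt_atTop 0] with n hn
  have hn' : (n : ℝ)⁻¹ ≠ 0 := inv_ne_zero (by exact_mod_cast hn.ne')
  rw [ContFracScaling.scaling, log_prod_digit hx4 hx]
  simp only [Pi.div_apply, birkhoffAverage, smul_eq_mul]
  exact mul_div_mul_left _ _ hn'

end

theorem fact5 :
    Multipliable ContFracScaling.khinchinFactor ∧
    ((0.8325 : ℝ) ≤ ContFracScaling.alphaZero ∧ ContFracScaling.alphaZero < 0.8326) ∧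
    (∀ᵐ x ∂ContFracScaling.unitLebesgue, x ∈ Set.Ioo (0 : ℝ) 1 →
      Tendsto (fun n : ℕ => Real.log (∏ i ∈ Finset.range n, ContFracScaling.digit x i) /
          Real.log (ContFracScaling.den x n))
        atTop (𝓝 ContFracScaling.alphaZero)) ∧
    ContFracScaling.unitLebesgue
      (ContFracScaling.levelSet ContFracScaling.alphaZero) = 1 := by
  refine ⟨hasProd_khinchinFactor.multipliable, alphaZero_mem_Ico, ?_, ?_⟩
  · filter_upwards [ae_mem_levelSet_alphaZero] with x hx _ using hx.2.2
  · have h : ContFracScaling.levelSet ContFracScaling.alphaZero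
        =ᵐ[ContFracScaling.unitLebesgue] Set.univ := eventuallyEq_univ.2 ae_mem_levelSet_alphaZero
    rw [measure_congr h]
    simp [ContFracScaling.unitLebesgue]
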